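/- Let $1/\sqrt5\le\lambda<1$ (in particular, $\lambda=1/\sqrt5$ is allowed), and let $\overline B(0,1)$ be the closed unit ball of $\mathbb R^3$ with the Euclidean norm. For a continuous curve $\gamma:[0,\infty)\to\mathbb R^3$ and $t\ge 0$, let $\sec^+(t)$ be the set of all unit vectors $q$ of the form $$q=\lim_{k\to\infty}\frac{\gamma(t_k)-\gamma(t)}{\|\gamma(t_k)-\gamma(t)\|},\qquad t_k\to t,\quad t_k>t,\quad \gamma(t_k)\ne\gamma(t).$$ The curve $\gamma$ has the $\lambda$-cone property if for every $t\ge 0$ and every $q\in\sec^+(t)$, $$\Big\langle q,\frac{\gamma(u)-\gamma(t)}{\|\gamma(u)-\gamma(t)\|}\Big\rangle\le\lambda\qquad\text{for all } 0\le u<t\text{ with }\gamma(u)\neq\gamma(t).$$ It is a $\lambda$-eel if it is continuous, has a nonzero right derivative at every $t\ge0$, and has the $\lambda$-cone property. Then there exists a $\lambda$-eel $\gamma:[0,\infty)\to\overline B(0,1)$ of infinite length (the supremum of $\sum_{i<m}\|\gamma(t_{i+1})-\gamma(t_i)\|$ over all finite sequences $0\le t_0<\dots<t_m$ is $+\infty$)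 such that $\lim_{t\to\infty}\gamma(t)$ exists. -/

import Mathlib

open Filter Topology

/-- The set `sec⁺(t)` of forward secants at `γ(t)` of a curve `γ : I → ℝᵈ`: all unit vectors that are
limits of `(γ(tₖ) - γ(t)) / ‖γ(tₖ) - γ(t)‖` along sequences `tₖ → t` in `I` with `tₖ > t`
(and `γ(tₖ) ≠ γ(t)`, so that the quotients are defined). -/
def forwardSecants {d : ℕ} (I : Set ℝ) (γ : ℝ → EuclideanSpace ℝ (Fin d)) (t : ℝ) :
    Set (EuclideanSpace ℝ (Fin d)) :=
  {q | q ∈ Metric.sphere (0 : EuclideanSpace ℝ (Fin d)) 1 ∧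
    ∃ s : ℕ → ℝ, (∀ k, s k ∈ I ∧ t < s k ∧ γ (s k) ≠ γ t) ∧ Tendsto s atTop (𝓝 t) ∧
      Tendsto (fun k => ‖γ (s k) - γ t‖⁻¹ • (γ (s k) - γ t)) atTop (𝓝 q)}

/-- The `lam`-cone property of a continuous curve `γ : I → ℝᵈ`: a forward secant `q` at any `t ∈ I`
satisfies `⟪q, (γ(u) - γ(t)) / ‖γ(u) - γ(t)‖⟫ ≤ lam` for all earlier times `u`
(with `γ(u) ≠ γ(t)`, so that the quotient is defined). -/
def HasConeProperty {d : ℕ} (lam : ℝ) (I : Set ℝ) (γ : ℝ → EuclideanSpace ℝ (Fin d)) : Prop :=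
  ContinuousOn γ I ∧
    ∀ t ∈ I, ∀ q ∈ forwardSecants I γ t, ∀ u ∈ I, u < t → γ u ≠ γ t →
      inner ℝ q (‖γ u - γ t‖⁻¹ • (γ u - γ t)) ≤ lam

/-- A `lam`-eel: a continuous curve on `I` that has a nonzero right derivative at each point and
the `lam`-cone property. -/
structure IsEel {d : ℕ} (lam : ℝ) (I : Set ℝ) (γ : ℝ → EuclideanSpace ℝ (Fin d)) : Prop where
  continuousOn : ContinuousOn γ I
  right_deriv : ∀ t ∈ I, ∃ v : EuclideanSpace ℝ (Fin d),
    v ≠ 0 ∧ HasDerivWithinAt γ v (I ∩ Set.Ioi t) t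
  cone : HasConeProperty lam I γ

/-- The length of a curve on `I`: the supremum of `∑ d(γ(tᵢ), γ(tᵢ₊₁))` over finite increasing
sequences in `I`, as an extended nonnegative real. -/
noncomputable def curveLength {d : ℕ} (I : Set ℝ) (γ : ℝ → EuclideanSpace ℝ (Fin d)) : ENNReal :=
  eVariationOn γ I

/-! A helix of slope 5/12 has unit tangents with vertical component ±5/13, below 1/√5. Points far
above or below it therefore satisfy the cone condition. If its radius is six times that of the past
it encloses, nearby past points do too, since they are seen almost radially. So a curve can sweep
the same height range repeatedly, up and down, on nested coaxial helices joined by horizontal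
outward segments.

Stage `j` consists of `2 * 2 ^ j + 1` such coils, preceded by a vertical rise after which all
earlier stages appear steeply below. Stages halve in size and shrink to the origin, yet `2 * 2 ^ j`
coils of height `stageHeight j` contribute length at least `2 * stageHeight 0` per stage, so the
length is infinite.

All cone inequalities hold with the constant 29/65 < 1/√5. The main cases are
`coil_inner_le_of_inCylinder` (inner coils), `coil_inner_le_of_spiral` (the current coil) and
`coil_inner_le_of_inEarlierStage`; `inPast_eelArc` shows that, with the radial segments, they cover
the past of a coil. -/

/-! ### Secants and concatenation of arcs -/

/-- A forward secant at a point with a nonzero right derivative is the normalized derivative. -/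
theorem forwardSecants_eq_of_hasDerivWithinAt {d : ℕ} {I : Set ℝ}
    {γ : ℝ → EuclideanSpace ℝ (Fin d)} {t : ℝ} {v q : EuclideanSpace ℝ (Fin d)} (hv : v ≠ 0)
    (hγ : HasDerivWithinAt γ v (I ∩ Set.Ioi t) t) (hq : q ∈ forwardSecants I γ t) :
    q = ‖v‖⁻¹ • v := by
  obtain ⟨-, s, hs, hst, hlim⟩ := hq
  have hslope := (hasDerivWithinAt_iff_tendsto_slope' (by simp)).mp hγ
  have hs' : Tendsto s atTop (𝓝[I ∩ Set.Ioi t] t) :=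
    tendsto_nhdsWithin_iff.mpr ⟨hst, Eventually.of_forall fun k => ⟨(hs k).1, (hs k).2.1⟩⟩
  have h1 := hslope.comp hs'
  have h2 := (h1.norm.inv₀ (norm_ne_zero_iff.mpr hv)).smul h1
  refine tendsto_nhds_unique hlim (h2.congr fun k => ?_)
  have hpos : 0 < s k - t := sub_pos.mpr (hs k).2.1
  have hne := norm_ne_zero_iff.mpr (sub_ne_zero.mpr (hs k).2.2)
  simp only [Function.comp, slope_def_module, norm_smul, norm_inv, Real.norm_eq_abs,
    abs_of_pos hpos, smul_smul]
  congr 1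
  field_simp

/-- The concatenation of the arcs `f n : [0, 1] → E`, the `n`-th of them run through during
`[n, n + 1)`. -/
noncomputable def concatCurve {E : Type*} (f : ℕ → ℝ → E) (t : ℝ) : E :=
  f ⌊t⌋₊ (t - ⌊t⌋₊)

theorem concatCurve_of_mem_Ico {E : Type*} (f : ℕ → ℝ → E) {n : ℕ} {t : ℝ}
    (h0 : (n : ℝ) ≤ t) (h1 : t < n + 1) : concatCurve f t = f n (t - n) := by
  have : ⌊t⌋₊ = n := (Nat.floor_eq_iff (n.cast_nonneg.trans h0)).mpr ⟨h0, h1⟩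
  rw [concatCurve, this]

theorem concatCurve_natCast {E : Type*} (f : ℕ → ℝ → E) (n : ℕ) :
    concatCurve f n = f n 0 := by
  simp [concatCurve]

theorem continuousOn_concatCurve {E : Type*} [TopologicalSpace E] {f : ℕ → ℝ → E}
    (hf : ∀ n, Continuous (f n)) (hmatch : ∀ n, f n 1 = f (n + 1) 0) :
    ContinuousOn (concatCurve f) (Set.Ici 0) := by
  have hIcc : ∀ n : ℕ, ContinuousOn (concatCurve f) (Set.Icc n (n + 1)) := by
    intro n
    refine ((hf n).comp (continuous_id.sub continuous_const)).continuousOn.congr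
      (f := fun t : ℝ => f n (t - n)) fun t ht => ?_
    rcases ht.2.lt_or_eq with h | h
    · exact concatCurve_of_mem_Ico f ht.1 h
    · have h' : t = ((n + 1 : ℕ) : ℝ) := by push_cast; exact h
      rw [h', concatCurve_natCast, ← hmatch]
      simp
  have hinit : ∀ n : ℕ, ContinuousOn (concatCurve f) (Set.Icc 0 (n + 1)) := by
    intro n
    induction n with
    | zero => simpa using hIcc 0
    | succ n ih =>
      have h := ih.union_of_isClosed (hIcc (n + 1)) isClosed_Icc isClosed_Icc
      push_cast at h
      rw [Set.Icc_union_Icc_eq_Icc (by positivity) (by linarith)] at h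
      push_cast
      exact h
  intro t ht
  have h := hinit ⌊t⌋₊ t ⟨ht, (Nat.lt_floor_add_one t).le⟩
  refine (h.mono_of_mem_nhdsWithin ?_)
  have : Set.Iio ((⌊t⌋₊ : ℝ) + 1) ∈ 𝓝 t := Iio_mem_nhds (Nat.lt_floor_add_one t)
  filter_upwards [self_mem_nhdsWithin, mem_nhdsWithin_of_mem_nhds this] with x hx hx'
  exact ⟨hx, hx'.le⟩

/-- Corners at the junctions are harmless: the right derivative there is the initial velocity of the
new arc, and it alone determines the forward secants. Clearing denominators leaves inequalities
between pairs of arcs. -/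
theorem isEel_concatCurve {d : ℕ} {lam : ℝ} {f f' : ℕ → ℝ → EuclideanSpace ℝ (Fin d)}
    (hder : ∀ n t, HasDerivAt (f n) (f' n t) t) (hne : ∀ n t, f' n t ≠ 0)
    (hmatch : ∀ n, f n 1 = f (n + 1) 0)
    (hpast : ∀ n, ∀ t ∈ Set.Ico (0 : ℝ) 1, ∀ m < n, ∀ s ∈ Set.Icc (0 : ℝ) 1,
      inner ℝ (f' n t) (f m s - f n t) ≤ lam * ‖f' n t‖ * ‖f m s - f n t‖)
    (hself : ∀ n, ∀ t ∈ Set.Ico (0 : ℝ) 1, ∀ s ∈ Set.Ico (0 : ℝ) t,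
      inner ℝ (f' n t) (f n s - f n t) ≤ lam * ‖f' n t‖ * ‖f n s - f n t‖) :
    IsEel lam (Set.Ici 0) (concatCurve f) := by
  have hcont : ContinuousOn (concatCurve f) (Set.Ici 0) :=
    continuousOn_concatCurve
      (fun n => continuous_iff_continuousAt.mpr fun t => (hder n t).continuousAt) hmatch
  have hright : ∀ t ∈ Set.Ici (0 : ℝ), HasDerivWithinAt (concatCurve f)
      (f' ⌊t⌋₊ (t - ⌊t⌋₊)) (Set.Ici 0 ∩ Set.Ioi t) t := by
    intro t ht
    have h1 : HasDerivAt (fun x => f ⌊t⌋₊ (x - ⌊t⌋₊)) (f' ⌊t⌋₊ (t - ⌊t⌋₊)) t :=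
      (hder ⌊t⌋₊ (t - ⌊t⌋₊)).comp_sub_const t _
    refine h1.hasDerivWithinAt.congr_of_eventuallyEq ?_ rfl
    have : Set.Iio ((⌊t⌋₊ : ℝ) + 1) ∈ 𝓝 t := Iio_mem_nhds (Nat.lt_floor_add_one t)
    filter_upwards [self_mem_nhdsWithin, mem_nhdsWithin_of_mem_nhds this] with x hx hx'
    exact concatCurve_of_mem_Ico f ((Nat.floor_le ht).trans (le_of_lt hx.2)) hx'
  refine ⟨hcont, fun t ht => ⟨_, hne _ _, hright t ht⟩, hcont, ?_⟩
  intro t ht q hq u hu hut hne'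
  rw [forwardSecants_eq_of_hasDerivWithinAt (hne _ _) (hright t ht) hq]
  have ht1 : t - ⌊t⌋₊ ∈ Set.Ico (0 : ℝ) 1 :=
    ⟨sub_nonneg.mpr (Nat.floor_le ht), by linarith [Nat.lt_floor_add_one t]⟩
  have hu1 : u - ⌊u⌋₊ ∈ Set.Ico (0 : ℝ) 1 :=
    ⟨sub_nonneg.mpr (Nat.floor_le hu), by linarith [Nat.lt_floor_add_one u]⟩
  have key : inner ℝ (f' ⌊t⌋₊ (t - ⌊t⌋₊)) (concatCurve f u - concatCurve f t) ≤
      lam * ‖f' ⌊t⌋₊ (t - ⌊t⌋₊)‖ * ‖concatCurve f u - concatCurve f t‖ := by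
    rcases (Nat.floor_mono hut.le).lt_or_eq with h | h
    · exact hpast _ _ ht1 _ h _ ⟨hu1.1, hu1.2.le⟩
    · unfold concatCurve
      rw [h]
      rw [h] at hu1
      exact hself _ _ ht1 _ ⟨hu1.1, by linarith⟩
  have hv := norm_pos_iff.mpr (hne ⌊t⌋₊ (t - ⌊t⌋₊))
  have hd := norm_pos_iff.mpr (sub_ne_zero.mpr hne')
  rw [inner_smul_left, inner_smul_right]
  simp only [map_inv₀, conj_trivial]
  rw [← mul_assoc, ← mul_inv, inv_mul_le_iff₀ (by positivity)]
  linarith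

/-! ### Coordinate estimates in three-space -/

theorem inner_euclidean_three (v d : EuclideanSpace ℝ (Fin 3)) :
    inner ℝ v d = v 0 * d 0 + v 1 * d 1 + v 2 * d 2 := by
  simp [PiLp.inner_apply, Fin.sum_univ_three, mul_comm]

theorem norm_sq_euclidean_three (v : EuclideanSpace ℝ (Fin 3)) :
    ‖v‖ ^ 2 = v 0 ^ 2 + v 1 ^ 2 + v 2 ^ 2 := by
  simp [EuclideanSpace.norm_sq_eq, Fin.sum_univ_three]

theorem hasDerivAt_euclidean_three {x y z : ℝ → ℝ} {x' y' z' t : ℝ} (hx : HasDerivAt x x' t)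
    (hy : HasDerivAt y y' t) (hz : HasDerivAt z z' t) :
    HasDerivAt (fun s => (!₂[x s, y s, z s] : EuclideanSpace ℝ (Fin 3))) !₂[x', y', z'] t := by
  have h : HasDerivAt (fun s => ![x s, y s, z s]) ![x', y', z'] t := by
    rw [hasDerivAt_pi]
    intro i
    fin_cases i <;> simpa
  exact ((PiLp.continuousLinearEquiv 2 ℝ fun _ : Fin 3 => ℝ).symm.hasFDerivAt).comp_hasDerivAt t h

/-- Square roots are avoided by replacing the two norms with explicit lower bounds `b` and `a`. -/
theorem inner_le_mul_norm_mul_norm_of_sq_le {v d : EuclideanSpace ℝ (Fin 3)} {c b a : ℝ}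
    (hc : 0 ≤ c) (hb : 0 ≤ b) (ha : 0 ≤ a) (hbv : b ^ 2 ≤ v 0 ^ 2 + v 1 ^ 2 + v 2 ^ 2)
    (had : a ^ 2 ≤ d 0 ^ 2 + d 1 ^ 2 + d 2 ^ 2)
    (h : v 0 * d 0 + v 1 * d 1 + v 2 * d 2 ≤ c * b * a) :
    inner ℝ v d ≤ c * ‖v‖ * ‖d‖ := by
  rw [← norm_sq_euclidean_three] at hbv had
  have h1 : b ≤ ‖v‖ := (sq_le_sq₀ hb (norm_nonneg _)).mp hbv
  have h2 : a ≤ ‖d‖ := (sq_le_sq₀ ha (norm_nonneg _)).mp had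
  rw [inner_euclidean_three]
  exact h.trans (by gcongr)

theorem inner_le_mul_norm_mul_norm_of_nonpos {v d : EuclideanSpace ℝ (Fin 3)} {c : ℝ}
    (hc : 0 ≤ c) (h : v 0 * d 0 + v 1 * d 1 + v 2 * d 2 ≤ 0) :
    inner ℝ v d ≤ c * ‖v‖ * ‖d‖ := by
  rw [inner_euclidean_three]
  exact h.trans (by positivity)

/-- Sine is first negative after π, when θ is already large. This bounds the backward pull of
earlier turns of a helix. -/
theorem neg_sin_le_div_four {θ : ℝ} (hθ : 0 ≤ θ) : -Real.sin θ ≤ θ / 4 := by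
  rcases le_total θ Real.pi with h | h
  · linarith [Real.sin_nonneg_of_nonneg_of_le_pi hθ h]
  · rcases le_total θ 4 with h4 | h4
    · have := Real.sin_le (sub_nonneg.mpr h)
      rw [Real.sin_sub_pi] at this
      linarith [Real.pi_gt_three]
    · linarith [Real.neg_one_le_sin θ]

/-! ### Dimensions and arcs of a stage -/

/-- The outer radius of the `j`-th stage. -/
noncomputable def stageRadius (j : ℕ) : ℝ := (1 / 2) ^ j / 2000

/-- The height of the `j`-th stage. -/
noncomputable def stageHeight (j : ℕ) : ℝ := 250 * Real.pi / 3 * stageRadius j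

/-- The radius from which the `k`-th coil of the `j`-th stage is approached; the coil itself has
radius `coilRadius j (k + 1)`. -/
noncomputable def coilRadius (j : ℕ) : ℕ → ℝ
  | 0 => 0
  -- The last coil, `k = 2 * 2 ^ j`, has the full radius of the stage.
  | k + 1 => stageRadius j / 6 ^ (2 * 2 ^ j - k)

/-- The relative height, `0` or `1`, at which the `k`-th coil starts. -/
noncomputable def startLevel (k : ℕ) : ℝ := (1 - (-1) ^ k) / 2

/-- A stage consists of a vertical segment, followed alternately by horizontal radial segments
and by coaxial helices of growing radii. -/
inductive StageStep : Type
  | rise : StageStep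
  | out : ℕ → StageStep
  | coil : ℕ → StageStep

open StageStep

/-- The arcs that make up the `j`-th stage. -/
noncomputable def stageArc (j : ℕ) : StageStep → ℝ → EuclideanSpace ℝ (Fin 3)
  | rise, t => !₂[-2 * stageRadius j, 0, -4 * stageHeight j + stageHeight j * t]
  | out k, t => !₂[-2 * stageRadius j +
      (coilRadius j k + (coilRadius j (k + 1) - coilRadius j k) * t), 0,
      -3 * stageHeight j + startLevel k * stageHeight j]
  | coil k, t => !₂[-2 * stageRadius j +
      coilRadius j (k + 1) * Real.cos ((100 * 6 ^ (2 * 2 ^ j - k) : ℕ) * (2 * Real.pi) * t),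
      coilRadius j (k + 1) * Real.sin ((100 * 6 ^ (2 * 2 ^ j - k) : ℕ) * (2 * Real.pi) * t),
      -3 * stageHeight j + (startLevel k + (-1) ^ k * t) * stageHeight j]

/-- The velocities of the arcs `stageArc`. -/
noncomputable def stageVelocity (j : ℕ) : StageStep → ℝ → EuclideanSpace ℝ (Fin 3)
  | rise, _ => !₂[0, 0, stageHeight j]
  | out k, _ => !₂[coilRadius j (k + 1) - coilRadius j k, 0, 0]
  | coil k, t => !₂[
      -(200 * Real.pi * stageRadius j) *
        Real.sin ((100 * 6 ^ (2 * 2 ^ j - k) : ℕ) * (2 * Real.pi) * t),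
      200 * Real.pi * stageRadius j *
        Real.cos ((100 * 6 ^ (2 * 2 ^ j - k) : ℕ) * (2 * Real.pi) * t),
      (-1) ^ k * stageHeight j]

theorem stageRadius_pos (j : ℕ) : 0 < stageRadius j := by unfold stageRadius; positivity

theorem stageHeight_pos (j : ℕ) : 0 < stageHeight j :=
  mul_pos (by positivity) (stageRadius_pos j)

theorem two_mul_stageRadius_succ (j : ℕ) : 2 * stageRadius (j + 1) = stageRadius j := by
  unfold stageRadius; ring

theorem two_mul_stageHeight_succ (j : ℕ) : 2 * stageHeight (j + 1) = stageHeight j := by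
  unfold stageHeight; rw [← two_mul_stageRadius_succ j]; ring

theorem two_mul_stageRadius_le {i j : ℕ} (h : i < j) : 2 * stageRadius j ≤ stageRadius i := by
  have : (1 / 2 : ℝ) ^ j ≤ (1 / 2) ^ (i + 1) := pow_le_pow_of_le_one (by norm_num) (by norm_num) h
  unfold stageRadius
  rw [pow_succ] at this
  linarith

theorem two_mul_stageHeight_le {i j : ℕ} (h : i < j) : 2 * stageHeight j ≤ stageHeight i := by
  unfold stageHeight
  have := two_mul_stageRadius_le h
  have := mul_le_mul_of_nonneg_left this (show 0 ≤ 250 * Real.pi / 3 by positivity)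
  linarith

theorem stageRadius_le_stageHeight (j : ℕ) : 250 * stageRadius j ≤ stageHeight j := by
  unfold stageHeight
  have := mul_le_mul_of_nonneg_right Real.pi_gt_three.le (stageRadius_pos j).le
  linarith

theorem coilRadius_succ_pos (j k : ℕ) : 0 < coilRadius j (k + 1) := by
  have := stageRadius_pos j
  unfold coilRadius
  positivity

theorem coilRadius_nonneg (j k : ℕ) : 0 ≤ coilRadius j k := by
  cases k with
  | zero => exact le_rfl
  | succ k => exact (coilRadius_succ_pos j k).le

theorem coilRadius_succ_le (j k : ℕ) : coilRadius j (k + 1) ≤ stageRadius j :=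
  div_le_self (stageRadius_pos j).le (one_le_pow₀ (by norm_num))

theorem six_mul_coilRadius_le {j k : ℕ} (hk : k ≤ 2 * 2 ^ j) :
    6 * coilRadius j k ≤ coilRadius j (k + 1) := by
  cases k with
  | zero => simpa [coilRadius] using (coilRadius_succ_pos j 0).le
  | succ k =>
    have h : 2 * 2 ^ j - k = 2 * 2 ^ j - (k + 1) + 1 := by omega
    simp only [coilRadius]
    rw [h, pow_succ]
    exact le_of_eq (by field_simp)

/-- The number of turns is inversely proportional to the radius, so all coils of a stage have the
same horizontal speed `200 * π * stageRadius j`, hence the same slope. -/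
theorem turns_mul_coilRadius (j k : ℕ) :
    ((100 * 6 ^ (2 * 2 ^ j - k) : ℕ) : ℝ) * coilRadius j (k + 1) = 100 * stageRadius j := by
  simp only [coilRadius]
  push_cast
  field_simp

theorem startLevel_mem (k : ℕ) :
    (startLevel k = 0 ∧ (-1 : ℝ) ^ k = 1) ∨ (startLevel k = 1 ∧ (-1 : ℝ) ^ k = -1) := by
  unfold startLevel
  rcases neg_one_pow_eq_or ℝ k with h | h <;> rw [h] <;> norm_num

theorem hasDerivAt_stageArc (j : ℕ) (S : StageStep) (t : ℝ) :
    HasDerivAt (stageArc j S) (stageVelocity j S t) t := by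
  cases S with
  | rise =>
    refine hasDerivAt_euclidean_three (hasDerivAt_const _ _) (hasDerivAt_const _ _) ?_
    simpa using ((hasDerivAt_id t).const_mul (stageHeight j)).const_add (-4 * stageHeight j)
  | out k =>
    refine hasDerivAt_euclidean_three ?_ (hasDerivAt_const _ _) (hasDerivAt_const _ _)
    simpa using ((((hasDerivAt_id t).const_mul
      (coilRadius j (k + 1) - coilRadius j k)).const_add (coilRadius j k)).const_add
      (-2 * stageRadius j))
  | coil k =>
    have hM := turns_mul_coilRadius j k
    have hα : HasDerivAt (fun t : ℝ => ((100 * 6 ^ (2 * 2 ^ j - k) : ℕ) : ℝ) * (2 * Real.pi) * t)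
        (((100 * 6 ^ (2 * 2 ^ j - k) : ℕ) : ℝ) * (2 * Real.pi)) t := by
      simpa using (hasDerivAt_id t).const_mul
        (((100 * 6 ^ (2 * 2 ^ j - k) : ℕ) : ℝ) * (2 * Real.pi))
    refine hasDerivAt_euclidean_three ?_ ?_ ?_
    · refine ((hα.cos.const_mul (coilRadius j (k + 1))).const_add
        (-2 * stageRadius j)).congr_deriv ?_
      linear_combination -(2 * Real.pi *
        Real.sin ((100 * 6 ^ (2 * 2 ^ j - k) : ℕ) * (2 * Real.pi) * t)) * hM
    · refine (hα.sin.const_mul (coilRadius j (k + 1))).congr_deriv ?_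
      linear_combination (2 * Real.pi *
        Real.cos ((100 * 6 ^ (2 * 2 ^ j - k) : ℕ) * (2 * Real.pi) * t)) * hM
    · simpa using ((((hasDerivAt_id t).const_mul ((-1 : ℝ) ^ k)).const_add
        (startLevel k)).mul_const (stageHeight j)).const_add (-3 * stageHeight j)

/-! ### Cylinders containing the stages -/

/-- The points of the `j`-th stage at distance at most `r` from its axis. -/
def InCylinder (j : ℕ) (r : ℝ) (p : EuclideanSpace ℝ (Fin 3)) : Prop :=
  -4 * stageHeight j ≤ p 2 ∧ p 2 ≤ -2 * stageHeight j ∧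
    (p 0 + 2 * stageRadius j) ^ 2 + p 1 ^ 2 ≤ r ^ 2

/-- The points of the stages before the `j`-th. -/
def InEarlierStage (j : ℕ) (p : EuclideanSpace ℝ (Fin 3)) : Prop :=
  ∃ i < j, InCylinder i (stageRadius i) p

theorem InCylinder.mono {j : ℕ} {r r' : ℝ} {p : EuclideanSpace ℝ (Fin 3)} (h : InCylinder j r p)
    (hr : 0 ≤ r) (hrr : r ≤ r') : InCylinder j r' p :=
  ⟨h.1, h.2.1, h.2.2.trans (by gcongr)⟩

theorem InEarlierStage.below {j : ℕ} {p : EuclideanSpace ℝ (Fin 3)} (h : InEarlierStage j p) :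
    p 2 ≤ -4 * stageHeight j := by
  obtain ⟨i, hi, -, h, -⟩ := h
  linarith [two_mul_stageHeight_le hi]

/-- Seen from the cylindrical part of a stage, the earlier stages lie steeply below. -/
theorem InEarlierStage.steep {j : ℕ} {p x : EuclideanSpace ℝ (Fin 3)} (h : InEarlierStage j p)
    (hx : InCylinder j (stageRadius j) x) (hx2 : -3 * stageHeight j ≤ x 2) :
    0 < x 2 - p 2 ∧ 15 * (|p 0 - x 0| + |p 1 - x 1|) ≤ x 2 - p 2 := by
  obtain ⟨i, hi, -, hp2, hp⟩ := h
  obtain ⟨-, -, hx⟩ := hx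
  have hR := stageRadius_pos j
  have hR' := stageRadius_pos i
  have h1 := abs_le_of_sq_le_sq (show (p 0 + 2 * stageRadius i) ^ 2 ≤ stageRadius i ^ 2 by
    nlinarith [sq_nonneg (p 1)]) hR'.le
  have h2 := abs_le_of_sq_le_sq (show p 1 ^ 2 ≤ stageRadius i ^ 2 by
    nlinarith [sq_nonneg (p 0 + 2 * stageRadius i)]) hR'.le
  have h3 := abs_le_of_sq_le_sq (show (x 0 + 2 * stageRadius j) ^ 2 ≤ stageRadius j ^ 2 by
    nlinarith [sq_nonneg (x 1)]) hR.le
  have h4 := abs_le_of_sq_le_sq (show x 1 ^ 2 ≤ stageRadius j ^ 2 by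
    nlinarith [sq_nonneg (x 0 + 2 * stageRadius j)]) hR.le
  have h5 := two_mul_stageRadius_le hi
  have h6 := two_mul_stageHeight_le hi
  have h7 := stageRadius_le_stageHeight i
  rw [abs_le] at h1 h2 h3 h4
  -- The vertical gap is at least `stageHeight i / 2`, hence at least 125 radii of stage `i`,
  -- against a horizontal offset of at most 4 + 2 radii; 15 · 6 = 90 < 125.
  have h8 : |p 0 - x 0| ≤ 4 * stageRadius i := abs_le.mpr ⟨by linarith, by linarith⟩
  have h9 : |p 1 - x 1| ≤ 2 * stageRadius i := abs_le.mpr ⟨by linarith, by linarith⟩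
  constructor <;> linarith

/-- The slope 5/12 makes the speed of a coil the rational multiple 13/12 of its horizontal speed. -/
theorem stageHeight_eq (j : ℕ) :
    stageHeight j = 5 / 12 * (200 * Real.pi * stageRadius j) := by
  unfold stageHeight; ring

theorem startLevel_add_mem {t : ℝ} (k : ℕ) (ht : t ∈ Set.Icc (0 : ℝ) 1) :
    0 ≤ startLevel k + (-1) ^ k * t ∧ startLevel k + (-1) ^ k * t ≤ 1 := by
  obtain ⟨h0, h1⟩ := ht
  rcases startLevel_mem k with ⟨h, h'⟩ | ⟨h, h'⟩ <;> rw [h, h'] <;> constructor <;> linarith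

theorem inCylinder_coil {j k : ℕ} {t : ℝ} (ht : t ∈ Set.Icc (0 : ℝ) 1) :
    InCylinder j (coilRadius j (k + 1)) (stageArc j (coil k) t) ∧
      -3 * stageHeight j ≤ stageArc j (coil k) t 2 := by
  have hH := stageHeight_pos j
  obtain ⟨h0, h1⟩ := startLevel_add_mem k ht
  have h2 := mul_le_mul_of_nonneg_right h1 hH.le
  have h3 := mul_nonneg h0 hH.le
  simp only [InCylinder, stageArc, PiLp.toLp_apply, Matrix.cons_val]
  refine ⟨⟨by linarith, by linarith, le_of_eq ?_⟩, by linarith⟩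
  linear_combination coilRadius j (k + 1) ^ 2 * Real.sin_sq_add_cos_sq
    ((100 * 6 ^ (2 * 2 ^ j - k) : ℕ) * (2 * Real.pi) * t)

theorem startLevel_nonneg_le (k : ℕ) : 0 ≤ startLevel k ∧ startLevel k ≤ 1 := by
  simpa using startLevel_add_mem k (t := 0) (by simp)

theorem inCylinder_out {j k : ℕ} (hk : k ≤ 2 * 2 ^ j) {t : ℝ} (ht : t ∈ Set.Icc (0 : ℝ) 1) :
    InCylinder j (coilRadius j (k + 1)) (stageArc j (out k) t) ∧
      -3 * stageHeight j ≤ stageArc j (out k) t 2 := by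
  have hH := stageHeight_pos j
  obtain ⟨h0, h1⟩ := startLevel_nonneg_le k
  have h2 := mul_le_mul_of_nonneg_right h1 hH.le
  have h3 := mul_nonneg h0 hH.le
  have h4 := six_mul_coilRadius_le hk
  have h5 := coilRadius_nonneg j k
  have h6 := mul_nonneg (show 0 ≤ coilRadius j (k + 1) - coilRadius j k by linarith) ht.1
  have h7 := mul_nonneg (show 0 ≤ coilRadius j (k + 1) - coilRadius j k by linarith)
    (sub_nonneg.mpr ht.2)
  simp only [InCylinder, stageArc, PiLp.toLp_apply, Matrix.cons_val]
  refine ⟨⟨by linarith, by linarith, ?_⟩, by linarith⟩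
  rw [zero_pow two_ne_zero, add_zero]
  exact pow_le_pow_left₀ (by linarith) (by linarith) 2

/-! ### Cone inequalities against each kind of past point -/

/-- A coil moves away from the points of the same stage that lie well inside it. -/
theorem coil_inner_le_of_inCylinder {j k : ℕ} (hk : k ≤ 2 * 2 ^ j) {t : ℝ}
    {p : EuclideanSpace ℝ (Fin 3)} (hp : InCylinder j (coilRadius j k) p) :
    inner ℝ (stageVelocity j (coil k) t) (p - stageArc j (coil k) t) ≤
      29 / 65 * ‖stageVelocity j (coil k) t‖ * ‖p - stageArc j (coil k) t‖ := by
  obtain ⟨-, -, hp⟩ := hp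
  have hρ := coilRadius_nonneg j k
  have hρr := six_mul_coilRadius_le hk
  have hr := coilRadius_succ_pos j k
  have hR := stageRadius_pos j
  set r := coilRadius j (k + 1)
  set ρ := coilRadius j k
  set α := ((100 * 6 ^ (2 * 2 ^ j - k) : ℕ) : ℝ) * (2 * Real.pi) * t with hα
  have hW : 0 < 200 * Real.pi * stageRadius j := by positivity
  have hH := stageHeight_eq j
  set W := 200 * Real.pi * stageRadius j
  set D := p 2 - (-3 * stageHeight j + (startLevel k + (-1) ^ k * t) * stageHeight j) with hD
  set P := p 0 + 2 * stageRadius j with hP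
  have hsc := Real.sin_sq_add_cos_sq α
  -- Tangential and, next, radial coordinate of the point in the frame rotating with the coil; both
  -- are at most `ρ ≤ r / 6`.
  have hw : -Real.sin α * P + Real.cos α * p 1 ≤ r / 6 := by
    refine (abs_le_of_sq_le_sq' (?_ : _ ≤ (r / 6) ^ 2) (by positivity)).2
    have : ρ ^ 2 ≤ (r / 6) ^ 2 := pow_le_pow_left₀ hρ (by linarith) 2
    nlinarith [sq_nonneg (Real.cos α * P + Real.sin α * p 1)]
  have hm : Real.cos α * P + Real.sin α * p 1 ≤ r / 6 := by
    refine (abs_le_of_sq_le_sq' (?_ : _ ≤ (r / 6) ^ 2) (by positivity)).2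
    have : ρ ^ 2 ≤ (r / 6) ^ 2 := pow_le_pow_left₀ hρ (by linarith) 2
    nlinarith [sq_nonneg (-Real.sin α * P + Real.cos α * p 1)]
  have hdist : (5 / 6 * r) ^ 2 ≤ (P - r * Real.cos α) ^ 2 + (p 1 - r * Real.sin α) ^ 2 := by
    have h1 : (P - r * Real.cos α) ^ 2 + (p 1 - r * Real.sin α) ^ 2 =
        (r - (Real.cos α * P + Real.sin α * p 1)) ^ 2 +
          (-Real.sin α * P + Real.cos α * p 1) ^ 2 := by
      linear_combination (r ^ 2 - P ^ 2 - p 1 ^ 2) * hsc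
    rw [h1]
    have h2 := pow_le_pow_left₀ (show 0 ≤ 5 / 6 * r by positivity)
      (show 5 / 6 * r ≤ r - (Real.cos α * P + Real.sin α * p 1) by linarith) 2
    nlinarith [sq_nonneg (-Real.sin α * P + Real.cos α * p 1)]
  have hsD : (-1 : ℝ) ^ k * D ≤ |D| := by
    rcases neg_one_pow_eq_or ℝ k with h | h <;> rw [h]
    · linarith [le_abs_self D]
    · linarith [neg_abs_le D]
  -- The inner product is at most `W * (5 * |D| + 2 * r) / 12`, which forces this `a`, as 29/65 ·
  -- 13/12 · 5/29 = 1/12. Cauchy–Schwarz with horizontal distance at least `5 / 6 * r` shows that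
  -- `a` bounds the distance from below.
  refine inner_le_mul_norm_mul_norm_of_sq_le (b := 13 / 12 * W) (a := (5 * |D| + 2 * r) / (29 / 5))
    (by norm_num) (by positivity) (by positivity) (le_of_eq ?_) ?_ ?_
  · simp only [stageVelocity, PiLp.toLp_apply, Matrix.cons_val, mul_pow, ← pow_mul, hH]
    rw [mul_comm k 2, pow_mul (-1 : ℝ) 2 k]
    simp only [← hα, W]
    norm_num
    linear_combination -(200 * Real.pi * stageRadius j) ^ 2 * hsc
  · simp only [stageArc, PiLp.sub_apply, Matrix.cons_val]
    have e : p 0 - (-2 * stageRadius j + r * Real.cos α) = P - r * Real.cos α := by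
      rw [hP]; ring
    rw [← hα, e, ← hD]
    have := sq_abs D
    nlinarith [sq_nonneg (|D| - r), sq_nonneg (|D|), sq_nonneg r]
  · simp only [stageArc, stageVelocity, PiLp.sub_apply, PiLp.toLp_apply, Matrix.cons_val]
    have e : p 0 - (-2 * stageRadius j + r * Real.cos α) = P - r * Real.cos α := by
      rw [hP]; ring
    rw [← hα, e, ← hD, hH]
    have h1 := mul_le_mul_of_nonneg_left hw hW.le
    have h2 := mul_le_mul_of_nonneg_left hsD hW.le
    linarith

/-- A coil moves away from the part of the solid spiral that it has passed. -/
theorem coil_inner_le_of_spiral {j k : ℕ} {t u r' : ℝ} (hut : u ≤ t) (hr' : 0 ≤ r')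
    (hr : r' ≤ coilRadius j (k + 1)) {p : EuclideanSpace ℝ (Fin 3)}
    (hp : p = !₂[-2 * stageRadius j +
      r' * Real.cos ((100 * 6 ^ (2 * 2 ^ j - k) : ℕ) * (2 * Real.pi) * u),
      r' * Real.sin ((100 * 6 ^ (2 * 2 ^ j - k) : ℕ) * (2 * Real.pi) * u),
      -3 * stageHeight j + (startLevel k + (-1) ^ k * u) * stageHeight j]) :
    inner ℝ (stageVelocity j (coil k) t) (p - stageArc j (coil k) t) ≤
      29 / 65 * ‖stageVelocity j (coil k) t‖ * ‖p - stageArc j (coil k) t‖ := by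
  subst hp
  have hrpos := coilRadius_succ_pos j k
  have hR := stageRadius_pos j
  have hM := turns_mul_coilRadius j k
  set M := ((100 * 6 ^ (2 * 2 ^ j - k) : ℕ) : ℝ)
  set r := coilRadius j (k + 1)
  set α := M * (2 * Real.pi) * t with hα
  set β := M * (2 * Real.pi) * u with hβ
  have hM0 : 0 ≤ M := Nat.cast_nonneg _
  have hW : 0 < 200 * Real.pi * stageRadius j := by positivity
  have hH := stageHeight_eq j
  have hθW : r * (α - β) = 200 * Real.pi * stageRadius j * (t - u) := by
    rw [hα, hβ]; linear_combination 2 * Real.pi * (t - u) * hM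
  set W := 200 * Real.pi * stageRadius j
  have hθ : 0 ≤ α - β := by
    rw [hα, hβ, ← mul_sub]
    have := sub_nonneg.mpr hut
    positivity
  have hsc := Real.sin_sq_add_cos_sq α
  have hs2 : ((-1 : ℝ) ^ k) ^ 2 = 1 := by rw [← pow_mul, mul_comm, pow_mul]; norm_num
  -- The vertical displacement alone suffices as `a`: in units of `W ^ 2 * (t - u)` the inner
  -- product is at most 1/4 − 25/144 = 11/144, and the allowance is 29/144.
  refine inner_le_mul_norm_mul_norm_of_sq_le (b := 13 / 12 * W) (a := 5 / 12 * W * (t - u))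
    (by norm_num) (by positivity) (mul_nonneg (by positivity) (sub_nonneg.mpr hut))
    (le_of_eq ?_) ?_ ?_
  · simp only [stageVelocity, PiLp.toLp_apply, Matrix.cons_val, hH]
    change _ = (-W * Real.sin α) ^ 2 + (W * Real.cos α) ^ 2 + ((-1) ^ k * (5 / 12 * W)) ^ 2
    linear_combination -W ^ 2 * hsc - (5 / 12 * W) ^ 2 * hs2
  · simp only [stageArc, PiLp.sub_apply, Matrix.cons_val]
    have e : -3 * stageHeight j + (startLevel k + (-1) ^ k * u) * stageHeight j -
        (-3 * stageHeight j + (startLevel k + (-1) ^ k * t) * stageHeight j) =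
        (-1) ^ k * (5 / 12 * W * (u - t)) := by rw [hH]; ring
    rw [e, mul_pow ((-1 : ℝ) ^ k), hs2]
    refine le_trans (le_of_eq ?_) (le_add_of_nonneg_left (add_nonneg (sq_nonneg _) (sq_nonneg _)))
    ring
  · simp only [stageArc, stageVelocity, PiLp.sub_apply, PiLp.toLp_apply, Matrix.cons_val]
    have hsin : -(r' * Real.sin (α - β)) ≤ W * (t - u) / 4 := by
      rw [← hθW]
      have h1 := mul_le_mul_of_nonneg_left (neg_sin_le_div_four hθ) hr'
      have h2 := mul_le_mul_of_nonneg_right hr hθ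
      linarith
    rw [Real.sin_sub] at hsin
    have h1 := mul_le_mul_of_nonneg_left hsin hW.le
    have h2 : 0 ≤ W * (W * (t - u)) := mul_nonneg hW.le (mul_nonneg hW.le (sub_nonneg.mpr hut))
    have e : -W * Real.sin α * (-2 * stageRadius j + r' * Real.cos β -
        (-2 * stageRadius j + r * Real.cos α)) +
        W * Real.cos α * (r' * Real.sin β - r * Real.sin α) +
        (-1) ^ k * stageHeight j *
          (-3 * stageHeight j + (startLevel k + (-1) ^ k * u) * stageHeight j -
          (-3 * stageHeight j + (startLevel k + (-1) ^ k * t) * stageHeight j)) =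
        W * -(r' * (Real.sin α * Real.cos β - Real.cos α * Real.sin β)) -
          25 / 144 * (W * (W * (t - u))) := by
      rw [hH]
      linear_combination (5 / 12 * W) ^ 2 * (u - t) * hs2
    refine e.trans_le ?_
    linarith

/-- This case fixes the constant: steepness 15 gives 1/15 + 5/12 = 29/60 = 29/65 · 13/12. A
descending coil heads towards the earlier stages, so the vertical term may be positive. -/
theorem coil_inner_le_of_inEarlierStage {j k : ℕ} {t : ℝ} (ht : t ∈ Set.Icc (0 : ℝ) 1)
    {p : EuclideanSpace ℝ (Fin 3)} (hp : InEarlierStage j p) :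
    inner ℝ (stageVelocity j (coil k) t) (p - stageArc j (coil k) t) ≤
      29 / 65 * ‖stageVelocity j (coil k) t‖ * ‖p - stageArc j (coil k) t‖ := by
  obtain ⟨hx, hx2⟩ := inCylinder_coil (j := j) (k := k) ht
  obtain ⟨hD, hd⟩ := hp.steep (hx.mono (coilRadius_nonneg _ _) (coilRadius_succ_le _ _)) hx2
  have hR := stageRadius_pos j
  have hW : 0 < 200 * Real.pi * stageRadius j := by positivity
  have hH := stageHeight_eq j
  set x := stageArc j (coil k) t
  set α := ((100 * 6 ^ (2 * 2 ^ j - k) : ℕ) : ℝ) * (2 * Real.pi) * t with hα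
  set W := 200 * Real.pi * stageRadius j with hWdef
  have hsc := Real.sin_sq_add_cos_sq α
  have hs2 : ((-1 : ℝ) ^ k) ^ 2 = 1 := by rw [← pow_mul, mul_comm, pow_mul]; norm_num
  refine inner_le_mul_norm_mul_norm_of_sq_le (b := 13 / 12 * W) (a := x 2 - p 2)
    (by norm_num) (by positivity) hD.le (le_of_eq ?_) ?_ ?_
  · simp only [stageVelocity, PiLp.toLp_apply, Matrix.cons_val, hH]
    rw [← hα, ← hWdef]
    linear_combination -W ^ 2 * hsc - (5 / 12 * W) ^ 2 * hs2
  · simp only [PiLp.sub_apply]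
    nlinarith [sq_nonneg (p 0 - x 0), sq_nonneg (p 1 - x 1)]
  · simp only [stageVelocity, PiLp.sub_apply, PiLp.toLp_apply, Matrix.cons_val, hH]
    rw [← hα, ← hWdef]
    have h0 : -Real.sin α * (p 0 - x 0) ≤ |p 0 - x 0| := by
      refine (le_abs_self _).trans ?_
      rw [abs_mul, abs_neg]
      exact mul_le_of_le_one_left (abs_nonneg _) (Real.abs_sin_le_one α)
    have h1 : Real.cos α * (p 1 - x 1) ≤ |p 1 - x 1| := by
      refine (le_abs_self _).trans ?_
      rw [abs_mul]
      exact mul_le_of_le_one_left (abs_nonneg _) (Real.abs_cos_le_one α)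
    have h2 : (-1 : ℝ) ^ k * (p 2 - x 2) ≤ x 2 - p 2 := by
      rcases neg_one_pow_eq_or ℝ k with h | h <;> rw [h] <;> linarith
    have h3 : -Real.sin α * (p 0 - x 0) + Real.cos α * (p 1 - x 1) +
        5 / 12 * ((-1 : ℝ) ^ k * (p 2 - x 2)) ≤ 29 / 60 * (x 2 - p 2) := by linarith
    have h4 := mul_le_mul_of_nonneg_left h3 hW.le
    linarith

theorem out_inner_le_of_inEarlierStage {j k : ℕ} (hk : k ≤ 2 * 2 ^ j) {t : ℝ}
    (ht : t ∈ Set.Icc (0 : ℝ) 1) {p : EuclideanSpace ℝ (Fin 3)} (hp : InEarlierStage j p) :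
    inner ℝ (stageVelocity j (out k) t) (p - stageArc j (out k) t) ≤
      29 / 65 * ‖stageVelocity j (out k) t‖ * ‖p - stageArc j (out k) t‖ := by
  obtain ⟨hx, hx2⟩ := inCylinder_out hk ht
  obtain ⟨hD, hd⟩ := hp.steep (hx.mono (coilRadius_nonneg _ _) (coilRadius_succ_le _ _)) hx2
  have h1 := six_mul_coilRadius_le hk
  have h2 := coilRadius_nonneg j k
  set x := stageArc j (out k) t
  have hB : 0 ≤ coilRadius j (k + 1) - coilRadius j k := by linarith
  refine inner_le_mul_norm_mul_norm_of_sq_le (b := coilRadius j (k + 1) - coilRadius j k)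
    (a := x 2 - p 2) (by norm_num) hB hD.le (le_of_eq ?_) ?_ ?_
  · simp [stageVelocity]
  · simp only [PiLp.sub_apply]
    nlinarith [sq_nonneg (p 0 - x 0), sq_nonneg (p 1 - x 1)]
  · simp only [stageVelocity, PiLp.sub_apply, PiLp.toLp_apply, Matrix.cons_val]
    have h3 : p 0 - x 0 ≤ 29 / 65 * (x 2 - p 2) := by
      linarith [le_abs_self (p 0 - x 0), abs_nonneg (p 1 - x 1)]
    have h4 := mul_le_mul_of_nonneg_left h3 hB
    linarith

/-! ### The past of an arc -/

/-- What is known about the points traversed before an arc is entered. -/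
def InPast (j : ℕ) : StageStep → EuclideanSpace ℝ (Fin 3) → Prop
  | rise, p => InEarlierStage j p
  | out k, p => InEarlierStage j p ∨ InCylinder j (coilRadius j k) p
  -- The last alternative is the radial segment just traversed, which leaves the inner cylinder.
  | coil k, p => InEarlierStage j p ∨ InCylinder j (coilRadius j k) p ∨
      ∃ r, 0 ≤ r ∧ r ≤ coilRadius j (k + 1) ∧ p = !₂[-2 * stageRadius j + r, 0,
        -3 * stageHeight j + startLevel k * stageHeight j]

/-- The `j`-th stage has `2 * 2 ^ j + 1` coils. -/
def IsStep (j : ℕ) : StageStep → Prop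
  | rise => True
  | out k => k ≤ 2 * 2 ^ j
  | coil k => k ≤ 2 * 2 ^ j

theorem inner_le_of_inPast {j : ℕ} {S : StageStep} (hS : IsStep j S) {t : ℝ}
    (ht : t ∈ Set.Icc (0 : ℝ) 1) {p : EuclideanSpace ℝ (Fin 3)} (hp : InPast j S p) :
    inner ℝ (stageVelocity j S t) (p - stageArc j S t) ≤
      29 / 65 * ‖stageVelocity j S t‖ * ‖p - stageArc j S t‖ := by
  cases S with
  | rise =>
    refine inner_le_mul_norm_mul_norm_of_nonpos (by norm_num) ?_
    simp only [stageArc, stageVelocity, PiLp.sub_apply, PiLp.toLp_apply, Matrix.cons_val]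
    have h1 := InEarlierStage.below hp
    have h2 := mul_nonneg (stageHeight_pos j).le ht.1
    have h3 := mul_nonneg (stageHeight_pos j).le
      (show 0 ≤ (-4 * stageHeight j + stageHeight j * t) - p 2 by linarith)
    linarith
  | out k =>
    rcases hp with hp | ⟨-, -, hp⟩
    · exact out_inner_le_of_inEarlierStage hS ht hp
    · refine inner_le_mul_norm_mul_norm_of_nonpos (by norm_num) ?_
      simp only [stageArc, stageVelocity, PiLp.sub_apply, PiLp.toLp_apply, Matrix.cons_val]
      have h1 := six_mul_coilRadius_le hS
      have h2 := coilRadius_nonneg j k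
      have h3 := (abs_le_of_sq_le_sq' (show (p 0 + 2 * stageRadius j) ^ 2 ≤ coilRadius j k ^ 2 by
        nlinarith [sq_nonneg (p 1)]) h2).2
      have h4 : 0 ≤ coilRadius j (k + 1) - coilRadius j k := by linarith
      have h5 := mul_nonneg h4 ht.1
      have h6 := mul_nonneg h4 (show 0 ≤ (-2 * stageRadius j + (coilRadius j k +
        (coilRadius j (k + 1) - coilRadius j k) * t)) - p 0 by linarith)
      linarith
  | coil k =>
    rcases hp with hp | hp | ⟨r, hr, hr', rfl⟩
    · exact coil_inner_le_of_inEarlierStage ht hp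
    · exact coil_inner_le_of_inCylinder hS hp
    -- The radial segment is the slice `u = 0` of the solid spiral.
    · exact coil_inner_le_of_spiral ht.1 hr hr' (by simp)

theorem inner_le_of_self {j : ℕ} {S : StageStep} (hS : IsStep j S) {s t : ℝ}
    (hst : s ≤ t) :
    inner ℝ (stageVelocity j S t) (stageArc j S s - stageArc j S t) ≤
      29 / 65 * ‖stageVelocity j S t‖ * ‖stageArc j S s - stageArc j S t‖ := by
  cases S with
  | rise =>
    refine inner_le_mul_norm_mul_norm_of_nonpos (by norm_num) ?_
    simp only [stageArc, stageVelocity, PiLp.sub_apply, PiLp.toLp_apply, Matrix.cons_val]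
    have := mul_nonneg (sq_nonneg (stageHeight j)) (sub_nonneg.mpr hst)
    linarith
  | out k =>
    refine inner_le_mul_norm_mul_norm_of_nonpos (by norm_num) ?_
    simp only [stageArc, stageVelocity, PiLp.sub_apply, PiLp.toLp_apply, Matrix.cons_val]
    have := mul_nonneg (sq_nonneg (coilRadius j (k + 1) - coilRadius j k)) (sub_nonneg.mpr hst)
    linarith
  | coil k => exact coil_inner_le_of_spiral hst (coilRadius_nonneg _ _) le_rfl rfl

theorem stageVelocity_ne_zero {j : ℕ} {S : StageStep} (hS : IsStep j S) (t : ℝ) :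
    stageVelocity j S t ≠ 0 := by
  intro h
  have hH := stageHeight_pos j
  cases S with
  | rise =>
    have h2 := congrArg (fun v : EuclideanSpace ℝ (Fin 3) => v 2) h
    simp [stageVelocity, hH.ne'] at h2
  | out k =>
    have h0 := congrArg (fun v : EuclideanSpace ℝ (Fin 3) => v 0) h
    simp [stageVelocity] at h0
    linarith [six_mul_coilRadius_le hS, coilRadius_nonneg j k, coilRadius_succ_pos j k]
  | coil k =>
    have h2 := congrArg (fun v : EuclideanSpace ℝ (Fin 3) => v 2) h
    simp [stageVelocity, hH.ne'] at h2

/-! ### Order of the arcs and their junctions -/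

/-- The arc that follows a given one. -/
def nextStep : ℕ × StageStep → ℕ × StageStep
  | (j, rise) => (j, out 0)
  | (j, out k) => (j, coil k)
  | (j, coil k) => if k < 2 * 2 ^ j then (j, out (k + 1)) else (j + 1, rise)

/-- The order in which the arcs are traversed. -/
def stepSequence (n : ℕ) : ℕ × StageStep := nextStep^[n] (0, rise)

theorem stepSequence_succ (n : ℕ) : stepSequence (n + 1) = nextStep (stepSequence n) :=
  Function.iterate_succ_apply' _ _ _

theorem isStep_stepSequence (n : ℕ) : IsStep (stepSequence n).1 (stepSequence n).2 := by
  induction n with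
  | zero => trivial
  | succ n ih =>
    rw [stepSequence_succ]
    rcases h : stepSequence n with ⟨j, _ | k | k⟩ <;> rw [h] at ih
    · exact Nat.zero_le _
    · exact ih
    · simp only [nextStep]
      split_ifs with hk
      · exact hk
      · trivial

theorem startLevel_succ (k : ℕ) : startLevel k + (-1) ^ k = startLevel (k + 1) := by
  unfold startLevel; ring

theorem coilRadius_last (j : ℕ) : coilRadius j (2 * 2 ^ j + 1) = stageRadius j := by
  simp [coilRadius]

theorem stageArc_one (j : ℕ) (S : StageStep) (hS : IsStep j S) :
    stageArc j S 1 = stageArc (nextStep (j, S)).1 (nextStep (j, S)).2 0 := by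
  cases S with
  | rise =>
    simp only [nextStep, stageArc, startLevel, coilRadius]
    congr 2
    · ring
    · congr 2
      · ring
  | out k =>
    simp only [nextStep, stageArc]
    simp
  | coil k =>
    have hcos : Real.cos ((100 * 6 ^ (2 * 2 ^ j - k) : ℕ) * (2 * Real.pi) * 1) = 1 := by
      rw [mul_one]; exact Real.cos_nat_mul_two_pi _
    have hsin : Real.sin ((100 * 6 ^ (2 * 2 ^ j - k) : ℕ) * (2 * Real.pi) * 1) = 0 := by
      rw [mul_one]
      convert Real.sin_nat_mul_pi (2 * (100 * 6 ^ (2 * 2 ^ j - k))) using 2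
      push_cast
      ring
    simp only [nextStep]
    split_ifs with hk
    · simp only [stageArc, hcos, hsin, ← startLevel_succ k]
      simp
    · have hk' : k = 2 * 2 ^ j := le_antisymm hS (not_lt.mp hk)
      subst hk'
      -- The last index is even, so the last coil ascends; its endpoint lies on the axis of the next
      -- stage, at the bottom of that stage.
      have hpow : (-1 : ℝ) ^ (2 * 2 ^ j) = 1 := by rw [pow_mul]; norm_num
      simp only [stageArc, hcos, hsin, coilRadius_last, startLevel, hpow,
        ← two_mul_stageRadius_succ j, ← two_mul_stageHeight_succ j]
      congr 2
      · ring
      · congr 2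
        · ring
        · ring

/-- Each coil's cylinder absorbs the inner cylinder and the radial segment; after the last coil the
whole stage counts as earlier. -/
theorem inPast_nextStep_of_inPast {j : ℕ} {S : StageStep} (hS : IsStep j S)
    {p : EuclideanSpace ℝ (Fin 3)} (hp : InPast j S p) :
    InPast (nextStep (j, S)).1 (nextStep (j, S)).2 p := by
  cases S with
  | rise => exact Or.inl hp
  | out k => exact hp.imp_right Or.inl
  | coil k =>
    have hH := stageHeight_pos j
    have hcyl : InEarlierStage j p ∨ InCylinder j (coilRadius j (k + 1)) p := by
      rcases hp with hp | hp | ⟨r, hr, hr', rfl⟩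
      · exact Or.inl hp
      · exact Or.inr (hp.mono (coilRadius_nonneg _ _)
          (by linarith [six_mul_coilRadius_le hS, coilRadius_nonneg j k]))
      · right
        obtain ⟨h0, h1⟩ := startLevel_nonneg_le k
        have h2 := mul_le_mul_of_nonneg_right h1 hH.le
        have h3 := mul_nonneg h0 hH.le
        simp only [InCylinder, Matrix.cons_val]
        refine ⟨by linarith, by linarith, ?_⟩
        have := pow_le_pow_left₀ hr hr' 2
        linarith
    simp only [nextStep]
    split_ifs with hk
    · exact hcyl
    · rcases hcyl with ⟨i, hi, h⟩ | h
      · exact ⟨i, hi.trans j.lt_succ_self, h⟩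
      · exact ⟨j, j.lt_succ_self, h.mono (coilRadius_nonneg _ _) (coilRadius_succ_le _ _)⟩

theorem inPast_nextStep_stageArc {j : ℕ} {S : StageStep} (hS : IsStep j S) {t : ℝ}
    (ht : t ∈ Set.Icc (0 : ℝ) 1) :
    InPast (nextStep (j, S)).1 (nextStep (j, S)).2 (stageArc j S t) := by
  cases S with
  | rise =>
    have hH := stageHeight_pos j
    have h1 := mul_nonneg hH.le ht.1
    have h2 := mul_nonneg hH.le (sub_nonneg.mpr ht.2)
    change InPast j (out 0) _
    right
    simp only [InCylinder, stageArc, Matrix.cons_val, coilRadius]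
    exact ⟨by linarith, by linarith, le_of_eq (by ring)⟩
  | out k =>
    have h1 := six_mul_coilRadius_le hS
    have h2 := coilRadius_nonneg j k
    have h3 := mul_nonneg (show 0 ≤ coilRadius j (k + 1) - coilRadius j k by linarith) ht.1
    have h4 := mul_nonneg (show 0 ≤ coilRadius j (k + 1) - coilRadius j k by linarith)
      (sub_nonneg.mpr ht.2)
    change InPast j (coil k) _
    exact Or.inr (Or.inr ⟨coilRadius j k + (coilRadius j (k + 1) - coilRadius j k) * t,
      by linarith, by linarith, rfl⟩)
  | coil k =>
    have h := (inCylinder_coil (j := j) (k := k) ht).1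
    simp only [nextStep]
    split_ifs with hk
    · exact Or.inr h
    · exact ⟨j, j.lt_succ_self, h.mono (coilRadius_nonneg _ _) (coilRadius_succ_le _ _)⟩

/-- The `n`-th arc of the eel. -/
noncomputable def eelArc (n : ℕ) : ℝ → EuclideanSpace ℝ (Fin 3) :=
  stageArc (stepSequence n).1 (stepSequence n).2

theorem inPast_eelArc {m n : ℕ} (h : m < n) {s : ℝ} (hs : s ∈ Set.Icc (0 : ℝ) 1) :
    InPast (stepSequence n).1 (stepSequence n).2 (eelArc m s) := by
  induction n, h using Nat.le_induction with
  | base =>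
    rw [stepSequence_succ]
    exact inPast_nextStep_stageArc (isStep_stepSequence m) hs
  | succ n _ ih =>
    rw [stepSequence_succ]
    exact inPast_nextStep_of_inPast (isStep_stepSequence n) ih

theorem isEel_concatCurve_eelArc {lam : ℝ} (hlam : 29 / 65 ≤ lam) :
    IsEel lam (Set.Ici 0) (concatCurve eelArc) := by
  refine isEel_concatCurve
    (f' := fun n => stageVelocity (stepSequence n).1 (stepSequence n).2)
    (fun n t => hasDerivAt_stageArc _ _ t)
    (fun n t => stageVelocity_ne_zero (isStep_stepSequence n) t) (fun n => ?_) ?_ ?_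
  · have := stageArc_one _ _ (isStep_stepSequence n)
    rwa [Prod.mk.eta, ← stepSequence_succ] at this
  · intro n t ht m hm s hs
    refine (inner_le_of_inPast (isStep_stepSequence n) ⟨ht.1, ht.2.le⟩
      (inPast_eelArc hm hs)).trans ?_
    unfold eelArc
    gcongr
  · intro n t ht s hs
    refine (inner_le_of_self (isStep_stepSequence n) hs.2.le).trans ?_
    unfold eelArc
    gcongr

/-! ### Convergence to the origin -/

theorem norm_stageArc_le {j : ℕ} {S : StageStep} (hS : IsStep j S) {t : ℝ}
    (ht : t ∈ Set.Icc (0 : ℝ) 1) : ‖stageArc j S t‖ ≤ (1 / 2) ^ j := by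
  have hcyl : InCylinder j (stageRadius j) (stageArc j S t) := by
    cases S with
    | rise =>
      have hH := stageHeight_pos j
      have h1 := mul_nonneg hH.le ht.1
      have h2 := mul_nonneg hH.le (sub_nonneg.mpr ht.2)
      simp only [InCylinder, stageArc, Matrix.cons_val]
      refine ⟨by linarith, by linarith, ?_⟩
      nlinarith [sq_nonneg (stageRadius j)]
    | out k => exact (inCylinder_out hS ht).1.mono (coilRadius_nonneg _ _) (coilRadius_succ_le _ _)
    | coil k => exact (inCylinder_coil ht).1.mono (coilRadius_nonneg _ _) (coilRadius_succ_le _ _)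
  obtain ⟨h1, h2, h3⟩ := hcyl
  have hR := stageRadius_pos j
  have hH := stageHeight_pos j
  set p := stageArc j S t
  have h4 := abs_le_of_sq_le_sq' (show (p 0 + 2 * stageRadius j) ^ 2 ≤ stageRadius j ^ 2 by
    nlinarith [sq_nonneg (p 1)]) hR.le
  have h5 := abs_le_of_sq_le_sq' (show p 1 ^ 2 ≤ stageRadius j ^ 2 by
    nlinarith [sq_nonneg (p 0 + 2 * stageRadius j)]) hR.le
  have hδ : (1 / 2 : ℝ) ^ j = 2000 * stageRadius j := by unfold stageRadius; ring
  have hH' : stageHeight j ≤ 263 * stageRadius j := by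
    unfold stageHeight
    have := mul_le_mul_of_nonneg_right Real.pi_lt_d2.le hR.le
    linarith
  refine (sq_le_sq₀ (norm_nonneg _) (by positivity)).mp ?_
  rw [norm_sq_euclidean_three, hδ]
  -- In units of the stage radius the coordinates are at most 3, 1 and 4 · 263 = 1052, well within
  -- the 2000 that defines `stageRadius`.
  have e0 : p 0 ^ 2 ≤ (3 * stageRadius j) ^ 2 := sq_le_sq' (by linarith) (by linarith)
  have e2 : p 2 ^ 2 ≤ (1052 * stageRadius j) ^ 2 := sq_le_sq' (by linarith) (by linarith)
  have e1 : p 1 ^ 2 ≤ stageRadius j ^ 2 := sq_le_sq' h5.1 h5.2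
  nlinarith [sq_nonneg (stageRadius j)]

theorem norm_concatCurve_eelArc_le {t : ℝ} (ht : 0 ≤ t) :
    ‖concatCurve eelArc t‖ ≤ (1 / 2) ^ (stepSequence ⌊t⌋₊).1 :=
  norm_stageArc_le (isStep_stepSequence _)
    ⟨sub_nonneg.mpr (Nat.floor_le ht), by linarith [Nat.lt_floor_add_one t]⟩

theorem monotone_stepSequence_fst : Monotone fun n => (stepSequence n).1 := by
  refine monotone_nat_of_le_succ fun n => ?_
  rw [stepSequence_succ]
  rcases stepSequence n with ⟨j, _ | k | k⟩
  · exact le_rfl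
  · exact le_rfl
  · simp only [nextStep]
    split_ifs
    · exact le_rfl
    · exact j.le_succ

theorem exists_stepSequence_eq_rise (j : ℕ) : ∃ n, stepSequence n = (j, rise) := by
  induction j with
  | zero => exact ⟨0, rfl⟩
  | succ j ih =>
    obtain ⟨n, hn⟩ := ih
    have hcoil : ∀ k ≤ 2 * 2 ^ j, ∃ m, stepSequence m = (j, coil k) := by
      intro k
      induction k with
      | zero => exact fun _ => ⟨n + 2, by simp [stepSequence_succ, hn, nextStep]⟩
      | succ k ihk =>
        intro hk
        obtain ⟨m, hm⟩ := ihk (k.le_succ.trans hk)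
        refine ⟨m + 2, ?_⟩
        rw [stepSequence_succ, stepSequence_succ, hm]
        simp only [nextStep]
        rw [if_pos (Nat.lt_of_succ_le hk)]
    obtain ⟨m, hm⟩ := hcoil _ le_rfl
    exact ⟨m + 1, by rw [stepSequence_succ, hm]; simp [nextStep]⟩

theorem tendsto_stepSequence_fst : Tendsto (fun n => (stepSequence n).1) atTop atTop :=
  tendsto_atTop_atTop_of_monotone monotone_stepSequence_fst fun j =>
    (exists_stepSequence_eq_rise j).imp fun n hn => by rw [hn]

theorem tendsto_concatCurve_eelArc : Tendsto (concatCurve eelArc) atTop (𝓝 0) := by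
  refine squeeze_zero_norm' (a := fun t : ℝ => (1 / 2 : ℝ) ^ (stepSequence ⌊t⌋₊).1) ?_ ?_
  · filter_upwards [eventually_ge_atTop 0] with t ht using norm_concatCurve_eelArc_le ht
  · exact (tendsto_pow_atTop_nhds_zero_of_lt_one (by norm_num) (by norm_num)).comp
      (tendsto_stepSequence_fst.comp tendsto_nat_floor_atTop)

/-! ### Infinite length -/

/-- The number of coils that precede an arc within its stage. -/
def coilsBefore : StageStep → ℕ
  | rise => 0
  | out k => k
  | coil k => k

theorem stageHeight_le_dist_coil (j k : ℕ) :
    stageHeight j ≤ dist (stageArc j (coil k) 1) (stageArc j (coil k) 0) := by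
  have h := PiLp.norm_apply_le (stageArc j (coil k) 1 - stageArc j (coil k) 0) 2
  rw [← dist_eq_norm] at h
  refine le_trans (le_of_eq ?_) h
  simp only [stageArc, PiLp.sub_apply, Matrix.cons_val]
  have e : -3 * stageHeight j + (startLevel k + (-1) ^ k * 1) * stageHeight j -
      (-3 * stageHeight j + (startLevel k + (-1) ^ k * 0) * stageHeight j) =
      (-1) ^ k * stageHeight j := by ring
  rw [e, norm_mul, norm_pow, norm_neg, norm_one, one_pow, one_mul,
    Real.norm_of_nonneg (stageHeight_pos j).le]

/-- Only coils are counted, each by its height. A finished stage is credited with `2 * 2 ^ j` coils,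
worth `2 * stageHeight 0`; its extra coil is discarded. -/
theorem le_sum_dist_eelArc (n : ℕ) :
    2 * stageHeight 0 * (stepSequence n).1 +
        coilsBefore (stepSequence n).2 * stageHeight (stepSequence n).1 ≤
      ∑ m ∈ Finset.range n, dist (eelArc m 1) (eelArc m 0) := by
  induction n with
  | zero => simp [stepSequence, coilsBefore]
  | succ n ih =>
    rw [Finset.sum_range_succ, stepSequence_succ]
    have hS := isStep_stepSequence n
    unfold eelArc at ih ⊢
    rcases h : stepSequence n with ⟨j, _ | k | k⟩ <;> rw [h] at ih hS
    · exact ih.trans (le_add_of_nonneg_right dist_nonneg)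
    · exact ih.trans (le_add_of_nonneg_right dist_nonneg)
    · have hd := stageHeight_le_dist_coil j k
      simp only [nextStep]
      simp only [coilsBefore] at ih
      split_ifs with hk
      · simp only [coilsBefore]
        push_cast
        linarith
      · have hk' : k = 2 * 2 ^ j := le_antisymm hS (not_lt.mp hk)
        subst hk'
        have hscale : (2 : ℝ) ^ j * stageHeight j = stageHeight 0 := by
          unfold stageHeight stageRadius
          rw [one_div, inv_pow]
          field_simp
        simp only [coilsBefore]
        push_cast at ih ⊢
        linarith [stageHeight_pos j]

theorem curveLength_concatCurve_eelArc :
    curveLength (Set.Ici 0) (concatCurve eelArc) = ⊤ := by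
  refine ENNReal.eq_top_of_forall_nnreal_le fun c => ?_
  obtain ⟨N, hN⟩ := exists_nat_ge ((c : ℝ) / (2 * stageHeight 0))
  obtain ⟨n, hn⟩ := exists_stepSequence_eq_rise N
  have hH := stageHeight_pos 0
  have hc : (c : ℝ) ≤ ∑ m ∈ Finset.range n, dist (eelArc m 1) (eelArc m 0) := by
    refine le_trans ?_ (le_sum_dist_eelArc n)
    rw [hn, div_le_iff₀ (by positivity)] at *
    simp only [coilsBefore]
    push_cast
    linarith
  have hvar := eVariationOn.sum_le (f := concatCurve eelArc) (s := Set.Ici 0) (n := n)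
    (u := fun i : ℕ => (i : ℝ)) Nat.mono_cast fun i => Set.mem_Ici.mpr i.cast_nonneg
  refine le_trans ?_ hvar
  have hterm : ∀ i : ℕ, edist (concatCurve eelArc ((i + 1 : ℕ) : ℝ)) (concatCurve eelArc (i : ℝ)) =
      ENNReal.ofReal (dist (eelArc i 1) (eelArc i 0)) := by
    intro i
    have h1 := stageArc_one _ _ (isStep_stepSequence i)
    rw [Prod.mk.eta, ← stepSequence_succ] at h1
    rw [concatCurve_natCast, concatCurve_natCast, edist_dist]
    unfold eelArc
    rw [h1]
  simp only [hterm]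
  rw [← ENNReal.ofReal_sum_of_nonneg fun _ _ => dist_nonneg, ← ENNReal.ofReal_coe_nnreal]
  exact ENNReal.ofReal_le_ofReal hc

theorem theorem4p2 (lam : ℝ) (hlam : 1 / Real.sqrt 5 ≤ lam) (hlam1 : lam < 1) :
    ∃ γ : ℝ → EuclideanSpace ℝ (Fin 3),
      IsEel lam (Set.Ici 0) γ ∧
      Set.MapsTo γ (Set.Ici 0) (Metric.closedBall 0 1) ∧
      curveLength (Set.Ici 0) γ = ⊤ ∧
      ∃ p : EuclideanSpace ℝ (Fin 3), Tendsto γ atTop (𝓝 p) := by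
  -- Numerically, 29/65 ≈ 0.4462 and 1/√5 ≈ 0.4472.
  have h5 : (29 / 65 : ℝ) ≤ 1 / Real.sqrt 5 := by
    rw [le_div_iff₀ (by positivity)]
    have : Real.sqrt 5 ≤ 65 / 29 := Real.sqrt_le_iff.mpr (by norm_num)
    linarith
  refine ⟨concatCurve eelArc, isEel_concatCurve_eelArc (h5.trans hlam), fun t ht => ?_,
    curveLength_concatCurve_eelArc, 0, tendsto_concatCurve_eelArc⟩
  rw [mem_closedBall_zero_iff]
  exact (norm_concatCurve_eelArc_le ht).trans (pow_le_one₀ (by norm_num) (by norm_num))
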